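/- Let $0\le p\le n$ and let $\operatorname{Gr}_{n,p}=\{P\in\mathbb R^{n\times n}: P^T=P,\ P^2=P,\ \operatorname{rank}P=p\}$ be the Grassmann manifold, a Riemannian submanifold of the space of symmetric matrices with tangent spaces $T_P\operatorname{Gr}_{n,p}=\{X: X^T=X,\ PX+XP=X\}$ and canonical metric $\langle X,Y\rangle_P=\kappa\operatorname{tr}(X^TY)$, where $\kappa>0$ is a fixed normalization constant (e.g. $\kappa=\tfrac12$ or $\kappa=1$). Let $\operatorname{Exp}$ be its exponential map, and let $I=I_{n,p}=\operatorname{diag}(1,\dots,1,0,\dots,0)$ ($p$ ones). For $P,Q\in \operatorname{Gr}_{n,p}$ not in each other's cut locus (equivalently, on $\operatorname{Gr}_{n,p}$: joined by exactly one shortest geodesic), let $\operatorname{Log}_P(Q)\in T_P\operatorname{Gr}_{n,p}$ be the initial velocity of the unique shortest geodesic $[0,1]\to\operatorname{Gr}_{n,p}$ from $P$ to $Q$, and let $\mathcal T_{P\to Q}$ be the (Levi-Civita) parallel transport along it. Put $$P\oplus_{gr}Q=\operatorname{Exp}_P\big(\mathcal T_{I\to P}(\operatorname{Log}_I(Q))\big),\qquad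 \ominus_{gr}P=\operatorname{Exp}_I(-\operatorname{Log}_I(P)),$$ $$\langle P,Q\rangle=\langle\operatorname{Log}_I(P),\operatorname{Log}_I(Q)\rangle_I,\qquad \|P\|=\sqrt{\langle P,P\rangle},\qquad d(P,Q)=\|\ominus_{gr}P\oplus_{gr}Q\| ,$$ where $d(P,Q)$ is defined when none of $P$, $Q$, $\ominus_{gr}P\oplus_{gr}Q$ is in the cut locus of $I$. **Theorem.** (i) For every $P\in\operatorname{Gr}_{n,p}$ not in the cut locus of $I$, the point $\ominus_{gr}P$ is not in the cut locus of $I$ either, and it is the unique such point $X$ with $X\oplus_{gr}P=I$. (ii) The Grassmann inverse map $\lambda(P)=\ominus_{gr}P$ is a Grassmann gyroisometry: for all $P,Q\in\operatorname{Gr}_{n,p}$ for which $d(P,Q)$ is defined, $d(\lambda(P),\lambda(Q))$ is defined as well and $$d(\lambda(P),\lambda(Q))=d(P,Q).$$ -/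

import Mathlib

open scoped Matrix

/-- The Grassmann manifold `Gr_{n,p}` from the projector perspective: a `p`-dimensional subspace of
`ℝⁿ` is represented by the orthogonal projector onto it, a symmetric idempotent of rank `p`. -/
def Gr (n p : ℕ) : Type :=
  {P : Matrix (Fin n) (Fin n) ℝ // Pᵀ = P ∧ P * P = P ∧ P.rank = p}

namespace Gr

variable {n p : ℕ}

/-- The projection matrix representing a point of `Gr n p`. -/
def mat (P : Gr n p) : Matrix (Fin n) (Fin n) ℝ := P.1

/-- The identity element `I_{n,p} = diag(1, …, 1, 0, …, 0)` (with `p` ones) of `Gr_{n,p}`. -/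
def base (hp : p ≤ n) : Gr n p :=
  ⟨Matrix.diagonal fun i : Fin n => if (i : ℕ) < p then (1 : ℝ) else 0, by
    refine ⟨Matrix.diagonal_transpose _, ?_, ?_⟩
    · rw [Matrix.diagonal_mul_diagonal]
      congr 1
      funext i
      split_ifs <;> simp
    · rw [Matrix.rank_diagonal]
      have e : {i : Fin n // (if (i : ℕ) < p then (1 : ℝ) else 0) ≠ 0} ≃ Fin p :=
        { toFun := fun i => ⟨i.1, by
            by_contra h
            exact i.2 (if_neg h)⟩
          invFun := fun j => ⟨⟨j.1, lt_of_lt_of_le j.2 hp⟩, by simp⟩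
          left_inv := fun i => by ext; rfl
          right_inv := fun j => by ext; rfl }
      rw [Fintype.card_congr e, Fintype.card_fin]⟩

/-- The tangent space `T_P Gr_{n,p}`, as a subspace of the symmetric matrices:
`{X | Xᵀ = X, P X + X P = X}`. -/
def tangent (P : Gr n p) : Submodule ℝ (Matrix (Fin n) (Fin n) ℝ) where
  carrier := {X | Xᵀ = X ∧ P.mat * X + X * P.mat = X}
  zero_mem' := by simp
  add_mem' := by
    rintro X Y ⟨hX, hX'⟩ ⟨hY, hY'⟩
    refine ⟨by rw [Matrix.transpose_add, hX, hY], ?_⟩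
    nth_rewrite 3 [← hX']
    nth_rewrite 3 [← hY']
    rw [mul_add, add_mul]
    abel
  smul_mem' := by
    rintro c X ⟨hX, hX'⟩
    refine ⟨by rw [Matrix.transpose_smul, hX], ?_⟩
    rw [Matrix.mul_smul, Matrix.smul_mul, ← smul_add, hX']

/-- The canonical (orthogonally invariant) Riemannian metric of `Gr_{n,p}`,
`⟨X, Y⟩_P = κ tr(Xᵀ Y)` on every tangent space. The positive constant `κ` fixes the
normalization: `κ = 1/2` and `κ = 1` (Frobenius) are both in use. -/
noncomputable def metric (κ : ℝ) (X Y : Matrix (Fin n) (Fin n) ℝ) : ℝ :=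
  κ * (Xᵀ * Y).trace

/-- `V` is a parallel vector field along the curve `γ`: it is tangent, differentiable, and its
covariant derivative vanishes. The Levi-Civita covariant derivative of a submanifold of a Euclidean
space is the tangential part of the ordinary derivative, so the condition is that the derivative of
`V` is orthogonal to the tangent space. (Orthogonality does not depend on `κ`; we take `κ = 1`.) -/
def IsParallelAlong (γ : ℝ → Gr n p) (V : ℝ → Matrix (Fin n) (Fin n) ℝ) : Prop :=
  (∀ t, V t ∈ tangent (γ t)) ∧
    ∀ t, ∃ D, HasDerivAt V D t ∧ ∀ X ∈ tangent (γ t), metric 1 D X = 0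

/-- `γ` is the geodesic of `Gr_{n,p}` with `γ 0 = P` and `γ' 0 = X`: a differentiable curve whose
velocity field is parallel along it. -/
def IsGeodesicFrom (P : Gr n p) (X : Matrix (Fin n) (Fin n) ℝ) (γ : ℝ → Gr n p) : Prop :=
  γ 0 = P ∧ ∃ V : ℝ → Matrix (Fin n) (Fin n) ℝ,
    (∀ t, HasDerivAt (fun s => (γ s).mat) (V t) t) ∧ IsParallelAlong γ V ∧ V 0 = X

open Classical in
/-- The exponential map: `Exp_P(X) = γ 1` for the geodesic `γ` with `γ 0 = P`, `γ' 0 = X`.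
(The value `P` is a placeholder for `X` not tangent at `P`.) -/
noncomputable def expMap (P : Gr n p) (X : Matrix (Fin n) (Fin n) ℝ) : Gr n p :=
  if h : ∃ γ : ℝ → Gr n p, IsGeodesicFrom P X γ then h.choose 1 else P

/-- `X` is the initial velocity of a shortest geodesic `t ↦ Exp_P(t X)`, `t ∈ [0,1]`, from `P`
to `Q`. (Comparison of lengths does not depend on `κ`; we take `κ = 1`.) -/
def IsShortest (P Q : Gr n p) (X : Matrix (Fin n) (Fin n) ℝ) : Prop :=
  X ∈ tangent P ∧ expMap P X = Q ∧
    ∀ Y ∈ tangent P, expMap P Y = Q → metric 1 X X ≤ metric 1 Y Y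

/-- `Log_P(Q)` is defined: there is exactly one shortest geodesic from `P` to `Q`. On a complete
Riemannian manifold this is so whenever `Q` is not in the cut locus of `P`; on `Gr_{n,p}` it is so
exactly then, since any two points one of whose principal angles is `π/2` are joined by at least
two shortest geodesics. -/
def LogDefined (P Q : Gr n p) : Prop :=
  ∃! X, IsShortest P Q X

open Classical in
/-- The logarithmic map: `Log_P(Q)` is the initial velocity of the unique shortest geodesic from
`P` to `Q` (and the placeholder `0` if it is not defined). -/
noncomputable def logMap (P Q : Gr n p) : Matrix (Fin n) (Fin n) ℝ :=
  if h : LogDefined P Q then h.choose else 0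

open Classical in
/-- Parallel transport of `X` from `P` to `Q` along the unique shortest geodesic from `P` to `Q`
(with placeholder `0` where there is none). -/
noncomputable def transport (P Q : Gr n p) (X : Matrix (Fin n) (Fin n) ℝ) :
    Matrix (Fin n) (Fin n) ℝ :=
  if h : LogDefined P Q ∧ ∃ (V : ℝ → Matrix (Fin n) (Fin n) ℝ) (γ : ℝ → Gr n p),
      IsGeodesicFrom P (logMap P Q) γ ∧ IsParallelAlong γ V ∧ V 0 = X
  then h.2.choose 1 else 0

/-- The binary operation `P ⊕ Q = Exp_P(T_{I → P}(Log_I(Q)))`, where `I = I_{n,p}`. -/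
noncomputable def gyroAdd (hp : p ≤ n) (P Q : Gr n p) : Gr n p :=
  expMap P (transport (base hp) P (logMap (base hp) Q))

/-- The scalar multiplication `t ⊗ P = Exp_I(t Log_I(P))`, where `I = I_{n,p}`. -/
noncomputable def gyroSMul (hp : p ≤ n) (t : ℝ) (P : Gr n p) : Gr n p :=
  expMap (base hp) (t • logMap (base hp) P)

/-- The inverse operation `⊖ P = (-1) ⊗ P = Exp_I(-Log_I(P))`. -/
noncomputable def gyroInv (hp : p ≤ n) (P : Gr n p) : Gr n p :=
  gyroSMul hp (-1) P

/-- The Grassmann inner product `⟨P, Q⟩ = ⟨Log_I(P), Log_I(Q)⟩_I`. -/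
noncomputable def gyroInner (hp : p ≤ n) (κ : ℝ) (P Q : Gr n p) : ℝ :=
  metric κ (logMap (base hp) P) (logMap (base hp) Q)

/-- The Grassmann norm `‖P‖ = √⟨P, P⟩`. -/
noncomputable def gyroNorm (hp : p ≤ n) (κ : ℝ) (P : Gr n p) : ℝ :=
  Real.sqrt (gyroInner hp κ P P)

/-- The Grassmann gyrodistance `d(P, Q) = ‖⊖ P ⊕ Q‖`. -/
noncomputable def gyroDist (hp : p ≤ n) (κ : ℝ) (P Q : Gr n p) : ℝ :=
  gyroNorm hp κ (gyroAdd hp (gyroInv hp P) Q)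

/-- `d(P, Q)` is defined: none of `P`, `Q`, `⊖ P ⊕ Q` is in the cut locus of `I_{n,p}`. -/
def GyroDistDefined (hp : p ≤ n) (P Q : Gr n p) : Prop :=
  LogDefined (base hp) P ∧ LogDefined (base hp) Q ∧
    LogDefined (base hp) (gyroAdd hp (gyroInv hp P) Q)

/-- Grassmann gyroisometry: `d(ω P, ω Q) = d(P, Q)` for all `P`, `Q` for which `d(P, Q)` is
defined; `d(ω P, ω Q)` has to be defined as well. -/
def IsGyroisometry (hp : p ≤ n) (κ : ℝ) (ω : Gr n p → Gr n p) : Prop :=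
  ∀ P Q : Gr n p, GyroDistDefined hp P Q →
    GyroDistDefined hp (ω P) (ω Q) ∧ gyroDist hp κ (ω P) (ω Q) = gyroDist hp κ P Q

end Gr

/-!
Orthogonal matrices act on `Gr n p` by conjugation and preserve its metric, and everything is
expressed through this action. The normal space at `P` consists of the symmetric matrices that
commute with `P`, so the velocity `V` of a curve `γ` governs parallel transport along it by the Lax
equation `W' = [[V, γ], W]`. Along a geodesic, `V` satisfies this equation too, which makes the
angular velocity `[V, γ]` constant. Hence the geodesic with initial velocity `X` at `P` is
`t ↦ exp (t [X, P]) • P`, and parallel transport along it is conjugation by the same rotations,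
the transvections.

With `τ_P` the transvection along the shortest geodesic from `I` to `P`, this gives
`P ⊕ Q = τ_P • Q` and `⊖ P = τ_P⁻¹ • I`, whence `X ⊕ P = I` if and only if `P = ⊖ X`. On the other
hand `⊖` is the geodesic symmetry at `I`, the action of the involution `2I - 1`. So this condition
is the same as `X = ⊖ P`, and `⊖` preserves `d` because every orthogonal matrix fixing `I` does.
-/

open NormedSpace

-- Only the topology of the matrix space matters; this norm makes it a normed star algebra.
open scoped Matrix.Norms.L2Operator

section OffDiagonal

variable {R : Type*} [Ring R]

/-- `A` is off-diagonal with respect to the idempotent `P`: its diagonal blocks `P A P` and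
`(1 - P) A (1 - P)` vanish. For a projector `P` these are the directions tangent to the variety of
idempotents, and `IsOffDiagonal` is the ring-theoretic half of the definition of `Gr.tangent`. -/
def IsOffDiagonal (P A : R) : Prop :=
  P * A + A * P = A

variable {P A B : R}

theorem isOffDiagonal_lie (hP : IsIdempotentElem P) (A : R) : IsOffDiagonal P ⁅A, P⁆ := by
  rw [IsIdempotentElem] at hP
  rw [IsOffDiagonal, Ring.lie_def]
  linear_combination (norm := noncomm_ring) A * hP - hP * A

namespace IsOffDiagonal

theorem mul_mul_self (hP : IsIdempotentElem P) (hA : IsOffDiagonal P A) : P * A * P = 0 := by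
  rw [IsIdempotentElem] at hP
  rw [IsOffDiagonal] at hA
  linear_combination (norm := noncomm_ring) hA * P - A * hP

theorem lie_lie (hP : IsIdempotentElem P) (hA : IsOffDiagonal P A) : ⁅⁅A, P⁆, P⁆ = A := by
  have hPAP := hA.mul_mul_self hP
  rw [IsIdempotentElem] at hP
  rw [IsOffDiagonal] at hA
  simp only [Ring.lie_def]
  linear_combination (norm := noncomm_ring) hA - 2 * hPAP + A * hP + hP * A

theorem commute_mul (hA : IsOffDiagonal P A) (hB : IsOffDiagonal P B) : Commute P (A * B) := by
  rw [IsOffDiagonal] at hA hB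
  rw [commute_iff_eq]
  linear_combination (norm := noncomm_ring) hA * B - A * hB

theorem map {S F : Type*} [Ring S] [FunLike F R S] [RingHomClass F R S] (f : F)
    (hA : IsOffDiagonal P A) : IsOffDiagonal (f P) (f A) := by
  rw [IsOffDiagonal, ← map_mul, ← map_mul, ← map_add, hA]

theorem commute_lie (hA : IsOffDiagonal P A) (hB : IsOffDiagonal P B) : Commute P ⁅A, B⁆ :=
  (hA.commute_mul hB).sub_right (hB.commute_mul hA)

theorem two_mul_sub_one_conj (hP : IsIdempotentElem P) (hA : IsOffDiagonal P A) :
    (2 * P - 1) * A * (2 * P - 1) = -A := by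
  have hPAP := hA.mul_mul_self hP
  rw [IsOffDiagonal] at hA
  linear_combination (norm := noncomm_ring) 4 * hPAP - 2 * hA

/-- The hypothesis `h` is the derivative of `P * B + B * P = B` along a curve whose velocities are
`A` in `P` and `D` in `B`. -/
theorem eq_lie_lie_of_commute {D : R} (hP : IsIdempotentElem P) (hA : IsOffDiagonal P A)
    (hB : IsOffDiagonal P B) (hD : Commute P D)
    (h : A * B + P * D + (D * P + B * A) = D) : D = ⁅⁅A, P⁆, B⁆ := by
  have hBA := (hB.commute_mul hA).eq
  have hDP := hD.eq
  rw [IsIdempotentElem] at hP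
  rw [IsOffDiagonal] at hA hB
  simp only [Ring.lie_def]
  linear_combination (norm := noncomm_ring)
    (2 * P - 1) * h + (2 * P - 1) * hDP - 4 * hP * D - hA * B - hB * A - hBA

end IsOffDiagonal

end OffDiagonal

section StarRing

variable {R : Type*} [NonUnitalRing R] [StarRing R] {A B : R}

theorem star_lie_of_isSelfAdjoint (hA : IsSelfAdjoint A) (hB : IsSelfAdjoint B) :
    star ⁅A, B⁆ = ⁅B, A⁆ := by
  rw [Ring.lie_def, Ring.lie_def, star_sub, star_mul, star_mul, hA.star_eq, hB.star_eq]

theorem lie_mem_skewAdjoint_of_isSelfAdjoint (hA : IsSelfAdjoint A) (hB : IsSelfAdjoint B) :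
    ⁅A, B⁆ ∈ skewAdjoint R := by
  rw [skewAdjoint.mem_iff, star_lie_of_isSelfAdjoint hA hB, Ring.lie_def, Ring.lie_def, neg_sub]

theorem isSelfAdjoint_lie_of_mem_skewAdjoint (hA : A ∈ skewAdjoint R) (hB : IsSelfAdjoint B) :
    IsSelfAdjoint ⁅A, B⁆ := by
  rw [isSelfAdjoint_iff, Ring.lie_def, star_sub, star_mul, star_mul, skewAdjoint.mem_iff.1 hA,
    hB.star_eq]
  noncomm_ring

end StarRing

theorem trace_mul_lie {m R : Type*} [Fintype m] [CommRing R] (A B C : Matrix m m R) :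
    (A * ⁅B, C⁆).trace = (⁅C, A⁆ * B).trace := by
  rw [Ring.lie_def, Ring.lie_def, mul_sub, sub_mul, Matrix.trace_sub, Matrix.trace_sub,
    ← mul_assoc, ← mul_assoc, Matrix.trace_mul_cycle A B C]

section Deriv

variable {𝔸 : Type*} [NormedRing 𝔸] [NormedAlgebra ℝ 𝔸] {A B : ℝ → 𝔸} {A' B' : 𝔸} {t : ℝ}

theorem isSelfAdjoint_of_hasDerivAt [StarRing 𝔸] [ContinuousStar 𝔸] [StarModule ℝ 𝔸]
    (hA : ∀ s, IsSelfAdjoint (A s)) (h : HasDerivAt A A' t) : IsSelfAdjoint A' := by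
  have hstar := h.star
  simp only [(hA _).star_eq] at hstar
  exact hstar.unique h

theorem hasDerivAt_lie (hA : HasDerivAt A A' t) (hB : HasDerivAt B B' t) :
    HasDerivAt (fun s => ⁅A s, B s⁆) (⁅A', B t⁆ + ⁅A t, B'⁆) t := by
  simp only [Ring.lie_def]
  refine ((hA.mul hB).sub (hB.mul hA)).congr_deriv ?_
  abel

theorem isOffDiagonal_of_hasDerivAt (hP : ∀ s, IsIdempotentElem (A s)) (h : HasDerivAt A A' t) :
    IsOffDiagonal (A t) A' := by
  have hsq := h.mul h
  rw [show A * A = A from funext fun s => hP s, add_comm] at hsq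
  exact hsq.unique h

theorem hasDerivAt_eq_lie_lie_of_commute (hP : ∀ s, IsIdempotentElem (A s))
    (hB : ∀ s, IsOffDiagonal (A s) (B s)) (hA' : HasDerivAt A A' t) (hB' : HasDerivAt B B' t)
    (hcomm : Commute (A t) B') : B' = ⁅⁅A', A t⁆, B t⁆ := by
  have hderiv := (hA'.mul hB').add (hB'.mul hA')
  rw [show A * B + B * A = B from funext fun s => hB s] at hderiv
  exact (isOffDiagonal_of_hasDerivAt hP hA').eq_lie_lie_of_commute (hP t) (hB t) hcomm
    (hderiv.unique hB')

end Deriv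

section Lax

variable {𝔸 : Type*} [NormedRing 𝔸] [NormedAlgebra ℝ 𝔸] [CompleteSpace 𝔸]

theorem exp_mul_exp_neg (A : 𝔸) : exp A * exp (-A) = 1 := by
  let := NormedAlgebra.restrictScalars ℚ ℝ 𝔸
  rw [← exp_add_of_commute (Commute.neg_right (Commute.refl A)), add_neg_cancel, exp_zero]

theorem hasDerivAt_exp_smul_conj (Ω : 𝔸) {W : ℝ → 𝔸} {W' : 𝔸} {t : ℝ} (hW : HasDerivAt W W' t) :
    HasDerivAt (fun s : ℝ => exp (s • Ω) * W s * exp (-(s • Ω)))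
      (exp (t • Ω) * (⁅Ω, W t⁆ + W') * exp (-(t • Ω))) t := by
  have hexp_neg : HasDerivAt (fun s : ℝ => exp (-(s • Ω))) (-Ω * exp (-(t • Ω))) t := by
    simpa only [smul_neg] using hasDerivAt_exp_smul_const' (-Ω) t
  refine (((hasDerivAt_exp_smul_const Ω t).mul hW).mul hexp_neg).congr_deriv ?_
  rw [Pi.mul_apply, Ring.lie_def]
  noncomm_ring

theorem hasDerivAt_lie_iff_eq_exp_conj (Ω : 𝔸) (W : ℝ → 𝔸) :
    (∀ t, HasDerivAt W ⁅Ω, W t⁆ t) ↔ ∀ t : ℝ, W t = exp (t • Ω) * W 0 * exp (-(t • Ω)) := by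
  constructor <;> intro hW t
  · have hconst (s : ℝ) :
        HasDerivAt (fun s : ℝ => exp (s • -Ω) * W s * exp (-(s • -Ω))) 0 s := by
      refine (hasDerivAt_exp_smul_conj (-Ω) (hW s)).congr_deriv ?_
      rw [Ring.lie_def, Ring.lie_def]
      noncomm_ring
    have hpull : exp (-(t • Ω)) * W t * exp (t • Ω) = W 0 := by
      simpa using is_const_of_deriv_eq_zero (fun s => (hconst s).differentiableAt)
        (fun s => (hconst s).deriv) t 0
    rw [← hpull]
    linear_combination (norm := noncomm_ring)
      -exp_mul_exp_neg (t • Ω) * W t * (exp (t • Ω) * exp (-(t • Ω))) -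
        W t * exp_mul_exp_neg (t • Ω)
  · rw [hW t]
    have hW' := hasDerivAt_exp_smul_conj Ω (hasDerivAt_const t (W 0))
    rw [← funext hW, add_zero] at hW'
    have hΩ : Commute (exp (t • Ω)) Ω := ((Commute.refl Ω).smul_left t).exp_left
    have hΩ' : Commute (exp (-(t • Ω))) Ω := ((Commute.refl Ω).smul_left t).neg_left.exp_left
    refine hW'.congr_deriv ?_
    rw [Ring.lie_def, Ring.lie_def]
    linear_combination (norm := noncomm_ring)
      hΩ.eq * W 0 * exp (-(t • Ω)) + exp (t • Ω) * W 0 * hΩ'.eq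

end Lax

namespace Gr

variable {n p : ℕ} {P Q : Gr n p} {X Y : Matrix (Fin n) (Fin n) ℝ}

section TangentSpace

theorem mat_injective : Function.Injective (mat : Gr n p → Matrix (Fin n) (Fin n) ℝ) :=
  Subtype.val_injective

theorem isStarProjection_mat (P : Gr n p) : IsStarProjection P.mat where
  isIdempotentElem := P.2.2.1
  isSelfAdjoint := by
    rw [isSelfAdjoint_iff, Matrix.star_eq_conjTranspose,
      Matrix.conjTranspose_eq_transpose_of_trivial]
    exact P.2.1

theorem mem_tangent_iff : X ∈ tangent P ↔ IsSelfAdjoint X ∧ IsOffDiagonal P.mat X := by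
  rw [isSelfAdjoint_iff, Matrix.star_eq_conjTranspose,
    Matrix.conjTranspose_eq_transpose_of_trivial]
  rfl

theorem lie_mem_skewAdjoint_of_mem_tangent (hX : X ∈ tangent P) :
    ⁅X, P.mat⁆ ∈ skewAdjoint (Matrix (Fin n) (Fin n) ℝ) :=
  lie_mem_skewAdjoint_of_isSelfAdjoint (mem_tangent_iff.1 hX).1 P.isStarProjection_mat.isSelfAdjoint

theorem lie_lie_of_mem_tangent (hX : X ∈ tangent P) : ⁅⁅X, P.mat⁆, P.mat⁆ = X :=
  (mem_tangent_iff.1 hX).2.lie_lie P.isStarProjection_mat.isIdempotentElem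

theorem lie_lie_mem_tangent (P : Gr n p) (hX : IsSelfAdjoint X) :
    ⁅⁅X, P.mat⁆, P.mat⁆ ∈ tangent P :=
  mem_tangent_iff.2
    ⟨isSelfAdjoint_lie_of_mem_skewAdjoint
      (lie_mem_skewAdjoint_of_isSelfAdjoint hX P.isStarProjection_mat.isSelfAdjoint)
      P.isStarProjection_mat.isSelfAdjoint,
    isOffDiagonal_lie P.isStarProjection_mat.isIdempotentElem _⟩

theorem metric_eq_trace (κ : ℝ) (hX : IsSelfAdjoint X) : metric κ X Y = κ * (X * Y).trace := by
  rw [metric, ← Matrix.conjTranspose_eq_transpose_of_trivial, ← Matrix.star_eq_conjTranspose,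
    hX.star_eq]

theorem forall_metric_eq_zero_iff_commute {D : Matrix (Fin n) (Fin n) ℝ} (hD : IsSelfAdjoint D) :
    (∀ X ∈ tangent P, metric 1 D X = 0) ↔ Commute P.mat D := by
  simp only [metric_eq_trace 1 hD, one_mul]
  constructor
  · intro h
    have htrace := h _ (lie_lie_mem_tangent P hD)
    rw [trace_mul_lie, ← star_lie_of_isSelfAdjoint hD P.isStarProjection_mat.isSelfAdjoint,
      Matrix.star_eq_conjTranspose, Matrix.trace_conjTranspose_mul_self_eq_zero_iff] at htrace
    exact (commute_iff_lie_eq.2 htrace).symm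
  · intro h X hX
    rw [← lie_lie_of_mem_tangent hX, trace_mul_lie, h.lie_eq, zero_mul, Matrix.trace_zero]

end TangentSpace

section ParallelFields

variable {γ : ℝ → Gr n p} {V W : ℝ → Matrix (Fin n) (Fin n) ℝ}

theorem isParallelAlong_iff_hasDerivAt (hγ : ∀ t, HasDerivAt (fun s => (γ s).mat) (V t) t) :
    IsParallelAlong γ W ↔
      (∀ t, W t ∈ tangent (γ t)) ∧ ∀ t, HasDerivAt W ⁅⁅V t, (γ t).mat⁆, W t⁆ t := by
  refine and_congr_right fun hW => forall_congr' fun t => ?_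
  have hW' (s : ℝ) := mem_tangent_iff.1 (hW s)
  constructor
  · rintro ⟨D, hD, horth⟩
    have hcomm := (forall_metric_eq_zero_iff_commute
      (isSelfAdjoint_of_hasDerivAt (fun s => (hW' s).1) hD)).1 horth
    have hD_eq := hasDerivAt_eq_lie_lie_of_commute (A := fun s => (γ s).mat)
      (fun s => (γ s).isStarProjection_mat.isIdempotentElem) (fun s => (hW' s).2) (hγ t) hD hcomm
    exact hD_eq ▸ hD
  · intro hD
    refine ⟨_, hD, (forall_metric_eq_zero_iff_commute
      (isSelfAdjoint_of_hasDerivAt (fun s => (hW' s).1) hD)).2 ?_⟩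
    exact (isOffDiagonal_lie (γ t).isStarProjection_mat.isIdempotentElem _).commute_lie (hW' t).2

end ParallelFields

section OrthogonalAction

/-- Conjugation by an orthogonal matrix, `A ↦ U A Uᵀ`. The orthogonal group is taken in the form of
the real unitary group: `Matrix.orthogonalGroup` puts a second star structure on `ℝ`. -/
abbrev conj : Matrix.unitaryGroup (Fin n) ℝ →*
    Matrix (Fin n) (Fin n) ℝ ≃⋆ₐ[ℝ] Matrix (Fin n) (Fin n) ℝ :=
  Unitary.conjStarAlgAut ℝ (Matrix (Fin n) (Fin n) ℝ)

variable (U : Matrix.unitaryGroup (Fin n) ℝ)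

theorem conj_inv_conj (A : Matrix (Fin n) (Fin n) ℝ) : conj U⁻¹ (conj U A) = A := by
  rw [map_inv]
  exact (conj U).symm_apply_apply A

theorem conj_conj_inv (A : Matrix (Fin n) (Fin n) ℝ) : conj U (conj U⁻¹ A) = A := by
  simpa only [inv_inv] using conj_inv_conj U⁻¹ A

theorem rank_conj (A : Matrix (Fin n) (Fin n) ℝ) : (conj U A).rank = A.rank := by
  rw [Unitary.conjStarAlgAut_apply, ← Unitary.coe_star, Matrix.rank_mul_eq_left_of_isUnit_det _ _
    (Matrix.UnitaryGroup.det_isUnit _), Matrix.rank_mul_eq_right_of_isUnit_det _ _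
    (Matrix.UnitaryGroup.det_isUnit U)]

theorem trace_conj (A : Matrix (Fin n) (Fin n) ℝ) : (conj U A).trace = A.trace := by
  rw [Unitary.conjStarAlgAut_apply, Matrix.trace_mul_cycle, Unitary.coe_star_mul_self, one_mul]

/-- The orthogonal group acts on `Gr n p` by moving subspaces, `P ↦ U P Uᵀ` on projectors. -/
instance : MulAction (Matrix.unitaryGroup (Fin n) ℝ) (Gr n p) where
  smul U P := ⟨conj U P.mat, by
    have hUP := P.isStarProjection_mat.map (conj U)
    rw [← Matrix.conjTranspose_eq_transpose_of_trivial, ← Matrix.star_eq_conjTranspose, rank_conj]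
    exact ⟨hUP.isSelfAdjoint, hUP.isIdempotentElem, P.2.2.2⟩⟩
  one_smul P := mat_injective (by change conj 1 P.mat = _; rw [map_one]; rfl)
  mul_smul U V P := mat_injective (by change conj (U * V) P.mat = _; rw [map_mul]; rfl)

theorem mat_smul (P : Gr n p) : (U • P).mat = conj U P.mat :=
  rfl

theorem conj_lie (A B : Matrix (Fin n) (Fin n) ℝ) : conj U ⁅A, B⁆ = ⁅conj U A, conj U B⁆ := by
  simp only [Ring.lie_def, map_sub, map_mul]

theorem conj_mem_tangent (hX : X ∈ tangent P) : conj U X ∈ tangent (U • P) := by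
  rw [mem_tangent_iff] at hX ⊢
  exact ⟨hX.1.map (conj U), hX.2.map (conj U)⟩

theorem metric_conj (κ : ℝ) (X Y : Matrix (Fin n) (Fin n) ℝ) :
    metric κ (conj U X) (conj U Y) = metric κ X Y := by
  rw [metric, metric, ← Matrix.conjTranspose_eq_transpose_of_trivial,
    ← Matrix.conjTranspose_eq_transpose_of_trivial, ← Matrix.star_eq_conjTranspose,
    ← Matrix.star_eq_conjTranspose, ← map_star, ← map_mul, trace_conj]

end OrthogonalAction

section Transvection

/-- The rotation `exp [X, P]`, which carries `P` along the geodesic with initial velocity `X` to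
its time-one point and realises parallel transport along it. -/
noncomputable def transvection (hX : X ∈ tangent P) : Matrix.unitaryGroup (Fin n) ℝ :=
  ⟨exp ⁅X, P.mat⁆, by
    let := NormedAlgebra.restrictScalars ℚ ℝ (Matrix (Fin n) (Fin n) ℝ)
    exact exp_mem_unitary_of_mem_skewAdjoint (lie_mem_skewAdjoint_of_mem_tangent hX)⟩

theorem coe_transvection (hX : X ∈ tangent P) :
    (transvection hX : Matrix (Fin n) (Fin n) ℝ) = exp ⁅X, P.mat⁆ :=
  rfl

theorem conj_transvection (hX : X ∈ tangent P) (A : Matrix (Fin n) (Fin n) ℝ) :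
    conj (transvection hX) A = exp ⁅X, P.mat⁆ * A * exp (-⁅X, P.mat⁆) := by
  let := NormedAlgebra.restrictScalars ℚ ℝ (Matrix (Fin n) (Fin n) ℝ)
  rw [Unitary.conjStarAlgAut_apply, coe_transvection, star_exp,
    skewAdjoint.mem_iff.1 (lie_mem_skewAdjoint_of_mem_tangent hX)]

theorem conj_transvection_smul (hX : X ∈ tangent P) (t : ℝ) (A : Matrix (Fin n) (Fin n) ℝ) :
    conj (transvection (Submodule.smul_mem _ t hX)) A =
      exp (t • ⁅X, P.mat⁆) * A * exp (-(t • ⁅X, P.mat⁆)) := by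
  rw [conj_transvection, Ring.lie_def, Ring.lie_def, smul_sub, smul_mul_assoc, mul_smul_comm]

theorem conj_transvection_zero_smul (hX : X ∈ tangent P) (A : Matrix (Fin n) (Fin n) ℝ) :
    conj (transvection (Submodule.smul_mem _ (0 : ℝ) hX)) A = A := by
  rw [conj_transvection_smul hX, zero_smul, neg_zero, exp_zero, one_mul, mul_one]

theorem transvection_neg (hX : X ∈ tangent P) :
    transvection (neg_mem hX) = (transvection hX)⁻¹ := by
  let := NormedAlgebra.restrictScalars ℚ ℝ (Matrix (Fin n) (Fin n) ℝ)
  refine Subtype.ext ?_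
  rw [← Unitary.star_eq_inv, Unitary.coe_star, coe_transvection, coe_transvection, star_exp,
    star_lie_of_isSelfAdjoint (mem_tangent_iff.1 hX).1 P.isStarProjection_mat.isSelfAdjoint,
    Ring.lie_def, Ring.lie_def, mul_neg, neg_mul, neg_sub_neg]

theorem transvection_conj (U : Matrix.unitaryGroup (Fin n) ℝ) (hX : X ∈ tangent P) :
    transvection (conj_mem_tangent U hX) = U * transvection hX * U⁻¹ := by
  refine Subtype.ext ?_
  change exp ⁅conj U X, conj U P.mat⁆ = conj U (exp ⁅X, P.mat⁆)
  rw [← conj_lie, Unitary.conjStarAlgAut_apply, Unitary.conjStarAlgAut_apply]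
  exact Matrix.exp_units_conj (Unitary.toUnits U) ⁅X, P.mat⁆

/-- The curve `t ↦ exp (t [X, P]) • P`, which is the geodesic through `P` with initial velocity
`X`. -/
noncomputable def geodesic (hX : X ∈ tangent P) (t : ℝ) : Gr n p :=
  transvection (Submodule.smul_mem _ t hX) • P

theorem mat_geodesic (hX : X ∈ tangent P) (t : ℝ) :
    (geodesic hX t).mat = exp (t • ⁅X, P.mat⁆) * P.mat * exp (-(t • ⁅X, P.mat⁆)) :=
  conj_transvection_smul hX t P.mat

theorem geodesic_zero (hX : X ∈ tangent P) : geodesic hX 0 = P :=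
  mat_injective (conj_transvection_zero_smul hX P.mat)

theorem geodesic_one (hX : X ∈ tangent P) : geodesic hX 1 = transvection hX • P := by
  simp only [geodesic, one_smul]

theorem eq_geodesic_iff_hasDerivAt (hX : X ∈ tangent P) {γ : ℝ → Gr n p} (hγ : γ 0 = P) :
    γ = geodesic hX ↔ ∀ t, HasDerivAt (fun s => (γ s).mat) ⁅⁅X, P.mat⁆, (γ t).mat⁆ t := by
  rw [hasDerivAt_lie_iff_eq_exp_conj ⁅X, P.mat⁆ (fun s => (γ s).mat), hγ, funext_iff]
  refine forall_congr' fun t => ?_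
  rw [← mat_geodesic, mat_injective.eq_iff]

theorem lie_conj_transvection_smul (hX : X ∈ tangent P) (t : ℝ) :
    ⁅conj (transvection (Submodule.smul_mem _ t hX)) X, (geodesic hX t).mat⁆ = ⁅X, P.mat⁆ := by
  have hcomm : Commute (exp (t • ⁅X, P.mat⁆)) ⁅X, P.mat⁆ :=
    ((Commute.refl _).smul_left t).exp_left
  rw [geodesic, mat_smul, ← conj_lie, conj_transvection_smul hX, hcomm.eq, mul_assoc,
    exp_mul_exp_neg, mul_one]

theorem hasDerivAt_geodesic (hX : X ∈ tangent P) (t : ℝ) :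
    HasDerivAt (fun s => (geodesic hX s).mat)
      (conj (transvection (Submodule.smul_mem _ t hX)) X) t := by
  refine ((eq_geodesic_iff_hasDerivAt hX (geodesic_zero hX)).1 rfl t).congr_deriv ?_
  rw [← lie_conj_transvection_smul hX t]
  exact lie_lie_of_mem_tangent (conj_mem_tangent _ hX)

theorem isParallelAlong_geodesic_iff (hX : X ∈ tangent P) {W : ℝ → Matrix (Fin n) (Fin n) ℝ} :
    IsParallelAlong (geodesic hX) W ↔
      W 0 ∈ tangent P ∧ ∀ t, W t = conj (transvection (Submodule.smul_mem _ t hX)) (W 0) := by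
  rw [isParallelAlong_iff_hasDerivAt (hasDerivAt_geodesic hX)]
  simp only [lie_conj_transvection_smul, hasDerivAt_lie_iff_eq_exp_conj,
    ← conj_transvection_smul hX]
  refine and_congr_left fun hW => ⟨fun h => geodesic_zero hX ▸ h 0, fun h t => ?_⟩
  rw [hW t]
  exact conj_mem_tangent _ h

theorem isParallelAlong_geodesic_conj (hX : X ∈ tangent P) (hY : Y ∈ tangent P) :
    IsParallelAlong (geodesic hX)
      fun t => conj (transvection (Submodule.smul_mem _ t hX)) Y := by
  rw [isParallelAlong_geodesic_iff, conj_transvection_zero_smul hX]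
  exact ⟨hY, fun _ => rfl⟩

theorem IsGeodesicFrom.hasDerivAt_mat {γ : ℝ → Gr n p} (hγ : IsGeodesicFrom P X γ) (t : ℝ) :
    HasDerivAt (fun s => (γ s).mat) ⁅⁅X, P.mat⁆, (γ t).mat⁆ t := by
  obtain ⟨rfl, V, hV, hpar, rfl⟩ := hγ
  have hV' := ((isParallelAlong_iff_hasDerivAt hV).1 hpar).2
  have hV_tangent (s : ℝ) := mem_tangent_iff.1 (hpar.1 s)
  have hangular (s : ℝ) : HasDerivAt (fun r => ⁅V r, (γ r).mat⁆) 0 s := by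
    have hcomm := (isOffDiagonal_lie (γ s).isStarProjection_mat.isIdempotentElem (V s)).commute_lie
      (hV_tangent s).2
    refine (hasDerivAt_lie (hV' s) (hV s)).congr_deriv ?_
    rw [hcomm.symm.lie_eq, (Commute.refl (V s)).lie_eq, add_zero]
  have hconst : ⁅V t, (γ t).mat⁆ = ⁅V 0, (γ 0).mat⁆ :=
    is_const_of_deriv_eq_zero (fun s => (hangular s).differentiableAt)
      (fun s => (hangular s).deriv) t 0
  rw [← hconst, lie_lie_of_mem_tangent (hpar.1 t)]
  exact hV t

theorem isGeodesicFrom_iff (hX : X ∈ tangent P) {γ : ℝ → Gr n p} :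
    IsGeodesicFrom P X γ ↔ γ = geodesic hX := by
  refine ⟨fun hγ => (eq_geodesic_iff_hasDerivAt hX hγ.1).2 hγ.hasDerivAt_mat, ?_⟩
  rintro rfl
  exact ⟨geodesic_zero hX, _, hasDerivAt_geodesic hX, isParallelAlong_geodesic_conj hX hX,
    conj_transvection_zero_smul hX X⟩

end Transvection

section ExpLog

theorem expMap_eq_transvection_smul (hX : X ∈ tangent P) : expMap P X = transvection hX • P := by
  have h : ∃ γ : ℝ → Gr n p, IsGeodesicFrom P X γ := ⟨_, (isGeodesicFrom_iff hX).2 rfl⟩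
  rw [expMap, dif_pos h, (isGeodesicFrom_iff hX).1 h.choose_spec, geodesic_one]

theorem smul_expMap (U : Matrix.unitaryGroup (Fin n) ℝ) (hX : X ∈ tangent P) :
    U • expMap P X = expMap (U • P) (conj U X) := by
  rw [expMap_eq_transvection_smul hX, expMap_eq_transvection_smul (conj_mem_tangent U hX),
    transvection_conj, smul_smul, smul_smul, inv_mul_cancel_right]

theorem IsShortest.smul (U : Matrix.unitaryGroup (Fin n) ℝ) (h : IsShortest P Q X) :
    IsShortest (U • P) (U • Q) (conj U X) := by
  refine ⟨conj_mem_tangent U h.1, by rw [← smul_expMap U h.1, h.2.1], fun Y hY hYQ => ?_⟩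
  have hY' := conj_mem_tangent U⁻¹ hY
  have hexp := smul_expMap U⁻¹ hY
  rw [inv_smul_smul] at hY'
  rw [hYQ, inv_smul_smul, inv_smul_smul] at hexp
  simpa only [metric_conj] using h.2.2 _ hY' hexp.symm

namespace LogDefined

theorem isShortest_logMap (h : LogDefined P Q) : IsShortest P Q (logMap P Q) := by
  rw [logMap, dif_pos h]
  exact h.choose_spec.1

theorem logMap_mem_tangent (h : LogDefined P Q) : logMap P Q ∈ tangent P :=
  h.isShortest_logMap.1

theorem expMap_logMap (h : LogDefined P Q) : expMap P (logMap P Q) = Q :=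
  h.isShortest_logMap.2.1

theorem smul (U : Matrix.unitaryGroup (Fin n) ℝ) (h : LogDefined P Q) :
    LogDefined (U • P) (U • Q) := by
  refine ⟨conj U (logMap P Q), h.isShortest_logMap.smul U, fun Y hY => ?_⟩
  have hY' := hY.smul U⁻¹
  rw [inv_smul_smul, inv_smul_smul] at hY'
  rw [← h.unique hY' h.isShortest_logMap, conj_conj_inv]

theorem logMap_smul (U : Matrix.unitaryGroup (Fin n) ℝ) (h : LogDefined P Q) :
    logMap (U • P) (U • Q) = conj U (logMap P Q) :=
  (h.smul U).unique (h.smul U).isShortest_logMap (h.isShortest_logMap.smul U)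

/-- The transvection along the shortest geodesic from `P` to `Q`. -/
noncomputable def transvection (h : LogDefined P Q) : Matrix.unitaryGroup (Fin n) ℝ :=
  Gr.transvection h.logMap_mem_tangent

theorem transvection_smul_self (h : LogDefined P Q) : h.transvection • P = Q := by
  rw [transvection, ← expMap_eq_transvection_smul, h.expMap_logMap]

theorem transport_eq (h : LogDefined P Q) (hY : Y ∈ tangent P) :
    transport P Q Y = conj h.transvection Y := by
  have hV : ∃ (V : ℝ → Matrix (Fin n) (Fin n) ℝ) (γ : ℝ → Gr n p),
      IsGeodesicFrom P (logMap P Q) γ ∧ IsParallelAlong γ V ∧ V 0 = Y :=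
    ⟨_, _, (isGeodesicFrom_iff h.logMap_mem_tangent).2 rfl,
      isParallelAlong_geodesic_conj h.logMap_mem_tangent hY,
      conj_transvection_zero_smul h.logMap_mem_tangent Y⟩
  obtain ⟨γ, hγ, hpar, hV₀⟩ := hV.choose_spec
  rw [(isGeodesicFrom_iff h.logMap_mem_tangent).1 hγ, isParallelAlong_geodesic_iff, hV₀] at hpar
  rw [transport, dif_pos ⟨h, hV⟩, hpar.2 1]
  simp only [one_smul, transvection]

theorem transvection_smul (U : Matrix.unitaryGroup (Fin n) ℝ) (h : LogDefined P Q) :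
    (h.smul U).transvection = U * h.transvection * U⁻¹ := by
  simp only [transvection, h.logMap_smul]
  exact transvection_conj U h.logMap_mem_tangent

theorem transport_smul (U : Matrix.unitaryGroup (Fin n) ℝ) (h : LogDefined P Q)
    (hY : Y ∈ tangent P) :
    transport (U • P) (U • Q) (conj U Y) = conj U (transport P Q Y) := by
  rw [(h.smul U).transport_eq (conj_mem_tangent U hY), h.transport_eq hY, h.transvection_smul,
    map_mul, map_mul]
  exact congrArg (fun A => conj U (conj h.transvection A)) (conj_inv_conj U Y)

end LogDefined

end ExpLog

section Reflection

/-- The orthogonal reflection `2P - 1` in the subspace that `P` represents. It acts on `Gr n p` as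
the geodesic symmetry at `P`. -/
def reflection (P : Gr n p) : Matrix.unitaryGroup (Fin n) ℝ :=
  ⟨2 * P.mat - 1, P.isStarProjection_mat.two_mul_sub_one_mem_unitary⟩

theorem reflection_inv (P : Gr n p) : (reflection P)⁻¹ = reflection P := by
  refine Subtype.ext ?_
  rw [← Unitary.star_eq_inv, Unitary.coe_star, reflection, star_sub, star_mul, star_one,
    star_ofNat, P.isStarProjection_mat.isSelfAdjoint.star_eq, (Commute.ofNat_right P.mat 2).eq]

theorem conj_reflection (P : Gr n p) (A : Matrix (Fin n) (Fin n) ℝ) :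
    conj (reflection P) A = (2 * P.mat - 1) * A * (2 * P.mat - 1) := by
  rw [Unitary.conjStarAlgAut_apply, ← Unitary.coe_star, Unitary.star_eq_inv, reflection_inv,
    reflection]

theorem conj_reflection_of_mem_tangent (hX : X ∈ tangent P) : conj (reflection P) X = -X := by
  rw [conj_reflection]
  exact (mem_tangent_iff.1 hX).2.two_mul_sub_one_conj P.isStarProjection_mat.isIdempotentElem

theorem reflection_smul_self (P : Gr n p) : reflection P • P = P := by
  have hP := P.isStarProjection_mat.isIdempotentElem.eq
  refine mat_injective ?_
  rw [mat_smul, conj_reflection]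
  linear_combination (norm := noncomm_ring) 4 * hP * P.mat

end Reflection

section Gyro

variable {hp : p ≤ n}

theorem gyroAdd_eq_transvection_smul (hP : LogDefined (base hp) P) (hQ : LogDefined (base hp) Q) :
    gyroAdd hp P Q = hP.transvection • Q := by
  rw [gyroAdd, hP.transport_eq hQ.logMap_mem_tangent]
  nth_rw 1 [← hP.transvection_smul_self]
  rw [← smul_expMap _ hQ.logMap_mem_tangent, hQ.expMap_logMap]

theorem gyroInv_eq_expMap_neg (hp : p ≤ n) (P : Gr n p) :
    gyroInv hp P = expMap (base hp) (-logMap (base hp) P) := by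
  rw [gyroInv, gyroSMul, neg_one_smul]

theorem gyroInv_eq_reflection_smul (hP : LogDefined (base hp) P) :
    gyroInv hp P = reflection (base hp) • P := by
  have hlog := hP.logMap_mem_tangent
  nth_rw 2 [← hP.expMap_logMap]
  rw [smul_expMap _ hlog, reflection_smul_self, conj_reflection_of_mem_tangent hlog,
    gyroInv_eq_expMap_neg]

theorem gyroInv_eq_transvection_inv_smul (hP : LogDefined (base hp) P) :
    gyroInv hp P = hP.transvection⁻¹ • base hp := by
  have hlog := hP.logMap_mem_tangent
  rw [gyroInv_eq_expMap_neg, expMap_eq_transvection_smul (neg_mem hlog), transvection_neg hlog,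
    LogDefined.transvection]

theorem logDefined_gyroInv (hP : LogDefined (base hp) P) : LogDefined (base hp) (gyroInv hp P) := by
  simpa only [gyroInv_eq_reflection_smul hP, reflection_smul_self] using
    hP.smul (reflection (base hp))

theorem gyroAdd_eq_base_iff (hP : LogDefined (base hp) P) (hQ : LogDefined (base hp) Q) :
    gyroAdd hp P Q = base hp ↔ P = gyroInv hp Q := by
  rw [gyroAdd_eq_transvection_smul hP hQ, ← eq_inv_smul_iff,
    ← gyroInv_eq_transvection_inv_smul hP, gyroInv_eq_reflection_smul hP,
    gyroInv_eq_reflection_smul hQ, ← inv_smul_eq_iff, reflection_inv, eq_comm]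

variable {U : Matrix.unitaryGroup (Fin n) ℝ} (hU : U • base hp = base hp)

include hU

theorem logMap_base_smul (hP : LogDefined (base hp) P) :
    logMap (base hp) (U • P) = conj U (logMap (base hp) P) := by
  simpa only [hU] using hP.logMap_smul U

theorem gyroAdd_smul (hP : LogDefined (base hp) P) (hQ : LogDefined (base hp) Q) :
    gyroAdd hp (U • P) (U • Q) = U • gyroAdd hp P Q := by
  have htransport := hP.transport_smul U hQ.logMap_mem_tangent
  have hmem : transport (base hp) P (logMap (base hp) Q) ∈ tangent P := by
    simpa only [hP.transport_eq hQ.logMap_mem_tangent, hP.transvection_smul_self] using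
      conj_mem_tangent hP.transvection hQ.logMap_mem_tangent
  rw [hU] at htransport
  rw [gyroAdd, gyroAdd, logMap_base_smul hU hQ, htransport, smul_expMap U hmem]

theorem gyroInv_smul (hP : LogDefined (base hp) P) :
    gyroInv hp (U • P) = U • gyroInv hp P := by
  rw [gyroInv_eq_expMap_neg, gyroInv_eq_expMap_neg, smul_expMap U (neg_mem hP.logMap_mem_tangent),
    hU, map_neg, logMap_base_smul hU hP]

theorem gyroNorm_smul (κ : ℝ) (hP : LogDefined (base hp) P) :
    gyroNorm hp κ (U • P) = gyroNorm hp κ P := by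
  rw [gyroNorm, gyroNorm, gyroInner, gyroInner, logMap_base_smul hU hP, metric_conj]

theorem isGyroisometry_smul (κ : ℝ) : IsGyroisometry hp κ (U • ·) := by
  rintro P Q ⟨hP, hQ, hPQ⟩
  have hbase {R : Gr n p} (hR : LogDefined (base hp) R) : LogDefined (base hp) (U • R) := by
    simpa only [hU] using hR.smul U
  have hadd : gyroAdd hp (gyroInv hp (U • P)) (U • Q) = U • gyroAdd hp (gyroInv hp P) Q := by
    rw [gyroInv_smul hU hP, gyroAdd_smul hU (logDefined_gyroInv hP) hQ]
  refine ⟨⟨hbase hP, hbase hQ, ?_⟩, ?_⟩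
  · rw [hadd]
    exact hbase hPQ
  · rw [gyroDist, gyroDist, hadd, gyroNorm_smul hU κ hPQ]

end Gyro

end Gr

theorem mainTheorem8 (n p : ℕ) (hp : p ≤ n) (κ : ℝ) (hκ : 0 < κ) :
    (∀ P : Gr n p, Gr.LogDefined (Gr.base hp) P →
      Gr.LogDefined (Gr.base hp) (Gr.gyroInv hp P) ∧
      Gr.gyroAdd hp (Gr.gyroInv hp P) P = Gr.base hp ∧
      ∀ X : Gr n p, Gr.LogDefined (Gr.base hp) X →
        Gr.gyroAdd hp X P = Gr.base hp → X = Gr.gyroInv hp P) ∧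
    Gr.IsGyroisometry hp κ (fun P : Gr n p => Gr.gyroInv hp P) := by
  constructor
  · intro P hP
    have hinv := Gr.logDefined_gyroInv hP
    exact ⟨hinv, (Gr.gyroAdd_eq_base_iff hinv hP).2 rfl,
      fun X hX => (Gr.gyroAdd_eq_base_iff hX hP).1⟩
  · intro P Q hPQ
    simpa only [Gr.gyroInv_eq_reflection_smul hPQ.1, Gr.gyroInv_eq_reflection_smul hPQ.2.1] using
      Gr.isGyroisometry_smul (Gr.reflection_smul_self (Gr.base hp)) κ P Q hPQ
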